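/- All groups considered are finite. For a finite group $G$ let $F(G)$ be its Fitting subgroup (the maximal nilpotent normal subgroup), put $\nu_0(G)=F(G)$, and let $\nu_{i+1}(G)$ be the smallest normal subgroup of $F(G)$ such that $\nu_i(G)/\nu_{i+1}(G)$ is a direct product of elementary abelian groups which is centralized by $F(G)$. The $F$-class of $G$ is the smallest $c\ge 0$ with $\nu_c(G)=1$, and the $F$-rank of $G$ is $|\nu_0(G)/\nu_1(G)|$. If $G$ has $F$-class $c$, then a group $H$ is a descendant of $G$ if $H$ has $F$-class $c+1$ and $H/\nu_c(H)\cong G$. Let $G$ be a finite group with an arbitrary finite generating family $g_1,\dots,g_n$, let $F$ be the free group on $f_1,\dots,f_n$, and let $\mu:F\to G$ be the epimorphism with $\mu(f_i)=g_i$. Put $R=\ker\mu$, $L=\mu^{-1}(F(G))$, let $k$ be the product of the distinct primes dividing the $F$-rank of $G$, and let $R^k$ be the subgroup generated by the $k$-th powers of elements of $R$. Put \[ K=[R,L]R^k,\qquad G^*=F/K,\qquad M=R/K\le G^*, \] and let $\mathrm{Aut}_M(G^*)$ be the group of all automorphisms of $G^*$ that map $M$ onto itself. Theorem. Let $U$ be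 a normal subgroup of $G^*$ with $U\le M$ such that $H=G^*/U$ is a descendant of $G$. Then every $\alpha\in\mathrm{Stab}_{\mathrm{Aut}_M(G^*)}(U)$ induces an automorphism $\alpha_{G^*/U}: xU\mapsto\alpha(x)U$ of $H$, and \[ \mathrm{Stab}_{\mathrm{Aut}_M(G^*)}(U)\to\mathrm{Aut}(H),\qquad \alpha\mapsto\alpha_{G^*/U}, \] is a surjective group homomorphism. -/

import Mathlib

open scoped Pointwise

noncomputable section

namespace FCentral

/-- The Fitting subgroup `F(G)`: for a finite group, the maximal nilpotent normal subgroup, which is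
the subgroup generated by all nilpotent normal subgroups. -/
def fitting (G : Type*) [Group G] : Subgroup G :=
  sSup {N : Subgroup G | N.Normal ∧ Group.IsNilpotent N}

/-- `Q` is a direct product of (finitely many, finite) elementary abelian groups
`(ℤ/p₁)^{d₁} × ⋯ × (ℤ/p_r)^{d_r}` with `p₁, …, p_r` prime. -/
def IsProdElementaryAbelian (Q : Type*) [Group Q] : Prop :=
  ∃ (r : ℕ) (p d : Fin r → ℕ), (∀ i, (p i).Prime) ∧
    Nonempty (Q ≃* Multiplicative ((i : Fin r) → Fin (d i) → ZMod (p i)))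

/-- For a subgroup `A` of `F(G)`: `N ≤ A` is a normal subgroup of `F(G)` such that `A/N` is a
direct product of elementary abelian groups which is centralized by `F(G)`, that is,
`f a f⁻¹ a⁻¹ ∈ N` for all `f ∈ F(G)` and `a ∈ A`. -/
def IsFCentralStep {G : Type*} [Group G] (A N : Subgroup G) : Prop :=
  N ≤ A ∧ (N.subgroupOf (fitting G)).Normal ∧
    (∃ _ : (N.subgroupOf A).Normal, IsProdElementaryAbelian (A ⧸ N.subgroupOf A)) ∧
    ∀ f ∈ fitting G, ∀ a ∈ A, f * a * f⁻¹ * a⁻¹ ∈ N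

/-- The `F`-central series: `ν₀(G) = F(G)`, and `ν_{i+1}(G)` is the smallest normal subgroup of
`F(G)` such that `ν_i(G)/ν_{i+1}(G)` is a direct product of elementary abelian groups which is
centralized by `F(G)`. -/
def nu (G : Type*) [Group G] : ℕ → Subgroup G
  | 0 => fitting G
  | i + 1 => sInf {N : Subgroup G | IsFCentralStep (nu G i) N}

/-- `G` has `F`-class `c`: `c` is the smallest integer with `ν_c(G) = 1`. -/
def HasFClass (G : Type*) [Group G] (c : ℕ) : Prop :=
  nu G c = ⊥ ∧ ∀ i < c, nu G i ≠ ⊥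

/-- `H` is a descendant of `G`: if `c` is the `F`-class of `G`, then `H` has `F`-class `c + 1` and
`H/ν_c(H) ≅ G`. -/
def IsDescendant (G H : Type*) [Group G] [Group H] : Prop :=
  ∃ c : ℕ, HasFClass G c ∧ HasFClass H (c + 1) ∧
    ∃ _ : (nu H c).Normal, Nonempty (H ⧸ nu H c ≃* G)

/-- The `F`-rank of `G`: the order of `ν₀(G)/ν₁(G)`. -/
def fRank (G : Type*) [Group G] : ℕ := (nu G 1).relIndex (nu G 0)

/-- The core of `n`: the product of the distinct primes dividing `n`. -/
def core (n : ℕ) : ℕ := ∏ p ∈ n.primeFactors, p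

/-- `R^k`, the subgroup generated by the `k`-th powers of the elements of `R`. -/
def powSubgroup {G : Type*} [Group G] (R : Subgroup G) (k : ℕ) : Subgroup G :=
  Subgroup.closure {y | ∃ x ∈ R, x ^ k = y}

instance powSubgroup_normal {G : Type*} [Group G] (R : Subgroup G) [hR : R.Normal] (k : ℕ) :
    (powSubgroup R k).Normal := by
  constructor
  intro n hn g
  unfold powSubgroup at hn ⊢
  induction hn using Subgroup.closure_induction with
  | mem y hy =>
    obtain ⟨x, hx, rfl⟩ := hy
    exact Subgroup.subset_closure ⟨g * x * g⁻¹, hR.conj_mem x hx g, conj_pow⟩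
  | one => simp
  | mul x y _ _ hx hy =>
    have h := mul_mem hx hy
    rwa [conj_mul] at h
  | inv x _ hx =>
    have h := inv_mem hx
    rwa [conj_inv] at h

section Cover

variable {G : Type*} [Group G] {n : ℕ} (g : Fin n → G)

/-- The presentation homomorphism `μ : F → G`, `f_i ↦ g_i`, from the free group on `n` generators. -/
def presMap : FreeGroup (Fin n) →* G := FreeGroup.lift g

/-- The covering kernel `K(G) = [R, L] R^k`, where `R = ker μ`, `L` is the full preimage of `F(G)`
under `μ`, and `k` is the core of the `F`-rank of `G`. -/
def coveringKernel : Subgroup (FreeGroup (Fin n)) :=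
  ⁅(presMap g).ker, (fitting G).comap (presMap g)⁆ ⊔
    powSubgroup (presMap g).ker (core (fRank G))

instance fitting_normal (G : Type*) [Group G] : (fitting G).Normal :=
  Subgroup.sSup_normal _ fun _ h => h.1

instance coveringKernel_normal : (coveringKernel g).Normal := by
  unfold coveringKernel
  infer_instance

/-- The covering group `G* = F/K(G)`. -/
abbrev CoveringGroup : Type := FreeGroup (Fin n) ⧸ coveringKernel g

/-- The multiplicator `M(G) = R/K(G)`, as a subgroup of `G*`. -/
def multiplicator : Subgroup (CoveringGroup g) :=
  (presMap g).ker.map (QuotientGroup.mk' (coveringKernel g))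

/-- `Aut_M(G*)`: the automorphisms of `G*` which leave `M(G)` setwise invariant. -/
def autM : Subgroup (MulAut (CoveringGroup g)) :=
  MulAction.stabilizer (MulAut (CoveringGroup g)) (multiplicator g)

end Cover

end FCentral

end

/-! Let β be an automorphism of H = G*/U. Since ν_c(G) = 1, every epimorphism H → G kills ν_c(H),
and comparing orders shows that its kernel is exactly ν_c(H) (`ker_eq_nu_of_surjective`). The series
is characteristic, so β preserves the kernel of the natural map H → G and induces a surjection δ of
G. The group G* is finite (`finite_coveringGroup`), so Gaschütz's lemma (`exists_generating_lift`)
lifts the β-images of the standard generators of H to generators u_i of G*. The endomorphism of the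
free group sending f_i to a preimage of u_i induces δ on G, hence respects R, L and K. It therefore
gives a surjective endomorphism of G*, which by finiteness is an automorphism α
(`exists_mulAut_coveringGroup`). As α covers β and δ, it stabilizes U and M. -/

open scoped commutatorElement

noncomputable section

namespace FCentral

/-! ### Gaschütz's lemma, by counting generating lifts. -/

section Gaschutz

variable {G Q ι : Type*} [Group G] [Group Q] [Finite G] [Finite ι]

/-- In a subgroup which maps onto `Q`, all tuples of `Q` have equally many lifts. -/
theorem ncard_lifts_in_subgroup_eq (f : G →* Q) (C : Subgroup G) (hC : C.map f = ⊤)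
    (y z : ι → Q) :
    {t : ι → G | f ∘ t = y ∧ Subgroup.closure (Set.range t) ≤ C}.ncard =
      {t : ι → G | f ∘ t = z ∧ Subgroup.closure (Set.range t) ≤ C}.ncard := by
  have hs : ∀ q : Q, ∃ c ∈ C, f c = q := fun q => by
    have : q ∈ C.map f := hC ▸ Subgroup.mem_top q
    exact this
  choose s hsC hs using hs
  -- Right translation by elements of C carries lifts of y inside C injectively to lifts of z inside
  -- C.
  have key : ∀ y z : ι → Q,
      Set.MapsTo (fun (t : ι → G) i => t i * ((s (y i))⁻¹ * s (z i)))
        {t : ι → G | f ∘ t = y ∧ Subgroup.closure (Set.range t) ≤ C}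
        {t : ι → G | f ∘ t = z ∧ Subgroup.closure (Set.range t) ≤ C} := by
    rintro y z t ⟨rfl, htC⟩
    refine ⟨?_, ?_⟩
    · funext i
      simp [hs]
    · rw [Subgroup.closure_le] at htC ⊢
      rintro _ ⟨i, rfl⟩
      exact C.mul_mem (htC ⟨i, rfl⟩) (C.mul_mem (C.inv_mem (hsC _)) (hsC _))
  have le : ∀ y z : ι → Q,
      {t : ι → G | f ∘ t = y ∧ Subgroup.closure (Set.range t) ≤ C}.ncard ≤
        {t : ι → G | f ∘ t = z ∧ Subgroup.closure (Set.range t) ≤ C}.ncard := fun y z =>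
    Set.ncard_le_ncard_of_injOn _ (key y z)
      (fun t _ u _ h => funext fun i => mul_right_cancel (congrFun h i)) (Set.toFinite _)
  exact le_antisymm (le y z) (le z y)

/-- The number of lifts of a generating tuple of `Q` which generate a given subgroup does not depend
on the tuple. -/
theorem ncard_generating_lifts_eq (f : G →* Q) {y z : ι → Q}
    (hy : Subgroup.closure (Set.range y) = ⊤) (hz : Subgroup.closure (Set.range z) = ⊤)
    (C : Subgroup G) :
    {t : ι → G | f ∘ t = y ∧ Subgroup.closure (Set.range t) = C}.ncard =
      {t : ι → G | f ∘ t = z ∧ Subgroup.closure (Set.range t) = C}.ncard := by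
  classical
  have := Fintype.ofFinite (Subgroup G)
  have := Fintype.ofFinite (ι → G)
  -- Sort the lifts inside C by the subgroup they generate: the totals agree for y and z, and the
  -- proper subgroups contribute equally by induction.
  induction C using WellFoundedLT.induction with
  | ind C ih =>
    by_cases hC : C.map f = ⊤
    · have split : ∀ y : ι → Q,
          {t : ι → G | f ∘ t = y ∧ Subgroup.closure (Set.range t) ≤ C}.ncard =
            {t : ι → G | f ∘ t = y ∧ Subgroup.closure (Set.range t) = C}.ncard +
            ∑ D ∈ Finset.univ.filter (fun D => D < C),
              {t : ι → G | f ∘ t = y ∧ Subgroup.closure (Set.range t) = D}.ncard := by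
        intro y
        rw [← Finset.sum_insert (f := fun D =>
            {t : ι → G | f ∘ t = y ∧ Subgroup.closure (Set.range t) = D}.ncard) (by simp)]
        simp only [Set.ncard_eq_toFinset_card']
        rw [Finset.card_eq_sum_card_fiberwise
          (f := fun t : ι → G => Subgroup.closure (Set.range t))
          (t := insert C (Finset.univ.filter (fun D => D < C)))]
        · refine Finset.sum_congr rfl fun D hD => congrArg _ ?_
          ext t
          simp only [Finset.mem_insert, Finset.mem_filter, Finset.mem_univ, true_and] at hD
          have hDC : D ≤ C := hD.elim le_of_eq le_of_lt
          simp only [Finset.mem_filter, Set.mem_toFinset, Set.mem_ofPred_eq]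
          exact ⟨fun h => ⟨h.1.1, h.2⟩, fun h => ⟨⟨h.1, h.2.trans_le hDC⟩, h.2⟩⟩
        · intro t ht
          simp only [Set.coe_toFinset, Set.mem_ofPred_eq] at ht
          simpa using ht.2.eq_or_lt
      have h1 := ncard_lifts_in_subgroup_eq f C hC y z
      rw [split y, split z, Finset.sum_congr rfl fun D hD => ih D (Finset.mem_filter.1 hD).2] at h1
      exact Nat.add_right_cancel h1
    · have empty : ∀ y : ι → Q, Subgroup.closure (Set.range y) = ⊤ →
          {t : ι → G | f ∘ t = y ∧ Subgroup.closure (Set.range t) = C} = ∅ := by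
        rintro y hy
        refine Set.eq_empty_iff_forall_notMem.2 ?_
        rintro t ⟨rfl, rfl⟩
        rw [MonoidHom.map_closure, ← Set.range_comp] at hC
        exact hC hy
      rw [empty y hy, empty z hz]

/-- **Gaschütz's lemma**: if a finite group is generated by a family indexed by `ι`, then every
generating family of a homomorphic image that is indexed by `ι` lifts to a generating family. -/
theorem exists_generating_lift (f : G →* Q) (hf : Function.Surjective f) (t : ι → G)
    (ht : Subgroup.closure (Set.range t) = ⊤) (y : ι → Q)
    (hy : Subgroup.closure (Set.range y) = ⊤) :
    ∃ u : ι → G, f ∘ u = y ∧ Subgroup.closure (Set.range u) = ⊤ := by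
  have hft : Subgroup.closure (Set.range (f ∘ t)) = ⊤ := by
    rw [Set.range_comp, ← MonoidHom.map_closure, ht, Subgroup.map_top_of_surjective f hf]
  have hpos : 0 < {u : ι → G | f ∘ u = f ∘ t ∧ Subgroup.closure (Set.range u) = ⊤}.ncard :=
    (Set.ncard_pos (Set.toFinite _)).2 ⟨t, rfl, ht⟩
  rw [ncard_generating_lifts_eq f hft hy] at hpos
  exact (Set.ncard_pos (Set.toFinite _)).1 hpos

end Gaschutz

/-! ### Elementary abelian products and functoriality of the F-central series. -/

/-- This intrinsic form visibly passes to subgroups. For the converse, a squarefree exponent forces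
every cyclic prime-power factor to have order 1 or p. -/
theorem isProdElementaryAbelian_iff {Q : Type*} [Group Q] :
    IsProdElementaryAbelian Q ↔
      Finite Q ∧ (∀ x y : Q, x * y = y * x) ∧ ∃ m, Squarefree m ∧ ∀ x : Q, x ^ m = 1 := by
  constructor
  · rintro ⟨r, p, d, hp, ⟨e⟩⟩
    have : ∀ i, NeZero (p i) := fun i => ⟨(hp i).ne_zero⟩
    refine ⟨?_, fun x y => e.injective (by rw [map_mul, map_mul, mul_comm]), ?_⟩
    · have : Finite (Multiplicative ((i : Fin r) → Fin (d i) → ZMod (p i))) :=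
        inferInstanceAs (Finite ((i : Fin r) → Fin (d i) → ZMod (p i)))
      exact Finite.of_equiv _ e.symm.toEquiv
    -- The primes may repeat; passing to the image keeps the product squarefree.
    · refine ⟨∏ q ∈ Finset.univ.image p, q, ?_, fun x => e.injective ?_⟩
      · refine Finset.squarefree_prod_of_pairwise_isCoprime ?_ ?_
        · intro a ha b hb hab
          simp only [Finset.coe_image, Set.mem_image] at ha hb
          obtain ⟨i, -, rfl⟩ := ha
          obtain ⟨j, -, rfl⟩ := hb
          exact Nat.coprime_iff_isRelPrime.1 ((Nat.coprime_primes (hp i) (hp j)).2 hab)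
        · intro a ha
          obtain ⟨i, -, rfl⟩ := Finset.mem_image.1 ha
          exact (hp i).squarefree
      · rw [map_pow, map_one]
        apply Multiplicative.toAdd.injective
        rw [toAdd_pow, toAdd_one]
        funext i j
        obtain ⟨c, hc⟩ := Finset.dvd_prod_of_mem (fun q => q)
          (Finset.mem_image_of_mem p (Finset.mem_univ i))
        simp only [Pi.smul_apply, Pi.zero_apply, nsmul_eq_mul]
        rw [hc]
        simp
  · rintro ⟨hfin, hcomm, m, hm, hpow⟩
    let : CommGroup Q := { (inferInstance : Group Q) with mul_comm := hcomm }
    obtain ⟨ι, hι, p, hp, e, ⟨f⟩⟩ := AddCommGroup.equiv_directSum_zmod_of_finite (Additive Q)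
    classical
    let f' : Additive Q ≃+ ((i : ι) → ZMod (p i ^ e i)) :=
      f.trans (DirectSum.addEquivProd fun i => ZMod (p i ^ e i))
    have hdvd : ∀ i, p i ^ e i ∣ m := fun i => by
      rw [← ZMod.natCast_eq_zero_iff]
      have h : m • f' (f'.symm (Pi.single i 1)) = 0 := by
        rw [← map_nsmul, show m • f'.symm (Pi.single i 1) = 0 from hpow _, map_zero]
      rw [AddEquiv.apply_symm_apply] at h
      simpa using congrFun h i
    have he : ∀ i, e i ≤ 1 := fun i => by
      by_contra h
      have h2 : p i * p i ∣ m := by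
        rw [← sq]
        exact (pow_dvd_pow _ (by omega)).trans (hdvd i)
      exact (hp i).not_isUnit (hm _ h2)
    -- The exponent, 0 or 1, also serves as the dimension, so trivial factors need not be discarded.
    have hz : ∀ i, Nonempty (ZMod (p i ^ e i) ≃+ (Fin (e i) → ZMod (p i))) := fun i => by
      have h01 : e i = 0 ∨ e i = 1 := by have := he i; omega
      rcases h01 with h | h <;> rw [h]
      · rw [pow_zero]
        exact ⟨AddEquiv.ofUnique⟩
      · rw [pow_one]
        exact ⟨(AddEquiv.piUnique fun _ : Fin 1 => ZMod (p i)).symm⟩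
    let σ := Fintype.equivFin ι
    refine ⟨Fintype.card ι, p ∘ σ.symm, e ∘ σ.symm, fun i => hp _, ⟨?_⟩⟩
    exact AddEquiv.toMultiplicativeRight <| f'.trans <|
      (AddEquiv.piCongrRight fun i => (hz i).some).trans
        (LinearEquiv.piCongrLeft' ℕ (fun i => Fin (e i) → ZMod (p i)) σ).toAddEquiv

theorem IsProdElementaryAbelian.of_injective {Q Q' : Type*} [Group Q] [Group Q'] (f : Q' →* Q)
    (hf : Function.Injective f) (h : IsProdElementaryAbelian Q) : IsProdElementaryAbelian Q' := by
  rw [isProdElementaryAbelian_iff] at h ⊢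
  obtain ⟨hfin, hcomm, m, hm, hpow⟩ := h
  exact ⟨Finite.of_injective f hf, fun x y => hf (by rw [map_mul, map_mul, hcomm]), m, hm,
    fun x => hf (by rw [map_pow, hpow, map_one])⟩

theorem isProdElementaryAbelian_of_subsingleton (Q : Type*) [Group Q] [Subsingleton Q] :
    IsProdElementaryAbelian Q :=
  isProdElementaryAbelian_iff.2
    ⟨inferInstance, fun _ _ => Subsingleton.elim _ _, 1, squarefree_one,
      fun _ => Subsingleton.elim _ _⟩

/-- Ensures that the infimum defining ν_{i+1} is not over the empty family, which would give the
whole group. -/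
theorem isFCentralStep_self {G : Type*} [Group G] {A : Subgroup G}
    (hn : ∀ f ∈ fitting G, ∀ a ∈ A, f * a * f⁻¹ ∈ A) : IsFCentralStep A A := by
  refine ⟨le_rfl, ⟨fun a ha f => hn f f.2 a ha⟩, ?_, fun f hf a ha =>
    A.mul_mem (hn f hf a ha) (A.inv_mem ha)⟩
  rw [Subgroup.subgroupOf_self]
  refine ⟨inferInstance, ?_⟩
  have := QuotientGroup.subsingleton_quotient_top (G := A)
  exact isProdElementaryAbelian_of_subsingleton _

theorem nu_le_fitting_and_conj_mem (G : Type*) [Group G] (i : ℕ) :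
    nu G i ≤ fitting G ∧ ∀ f ∈ fitting G, ∀ a ∈ nu G i, f * a * f⁻¹ ∈ nu G i := by
  induction i with
  | zero => exact ⟨le_rfl, fun f _ a ha => (fitting_normal G).conj_mem a ha f⟩
  | succ i ih =>
    have hle : nu G (i + 1) ≤ fitting G := fun x hx =>
      ih.1 (Subgroup.mem_sInf.1 hx _ (isFCentralStep_self ih.2))
    refine ⟨hle, fun f hf a ha => ?_⟩
    refine Subgroup.mem_sInf.2 fun N hN => ?_
    have haN := Subgroup.mem_sInf.1 ha N hN
    exact hN.2.1.conj_mem (⟨a, hle ha⟩ : fitting G) haN ⟨f, hf⟩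

/-- Homomorphisms that respect the Fitting subgroups respect the `F`-central series. -/
theorem nu_le_comap_nu {H G : Type*} [Group H] [Group G] (f : H →* G)
    (hf : fitting H ≤ (fitting G).comap f) (i : ℕ) : nu H i ≤ (nu G i).comap f := by
  induction i with
  | zero => exact hf
  | succ i ih =>
    intro x hx
    refine Subgroup.mem_sInf.2 fun N hN => ?_
    -- It suffices to pull each step N back to a step in H: the quotient of ν_i(H) by the pullback
    -- embeds in ν_i(G)/N.
    suffices h : IsFCentralStep (nu H i) (N.comap f ⊓ nu H i) from
      (Subgroup.mem_sInf.1 hx _ h).1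
    obtain ⟨hNle, hNF, ⟨hNn, hNQ⟩, hNc⟩ := hN
    obtain ⟨hle, hconj⟩ := nu_le_fitting_and_conj_mem H i
    have hker : (N.comap f ⊓ nu H i).subgroupOf (nu H i) =
        ((QuotientGroup.mk' (N.subgroupOf (nu G i))).comp
          ((f.comp (nu H i).subtype).codRestrict (nu G i) fun y => ih y.2)).ker := by
      ext y
      rw [← MonoidHom.comap_ker, QuotientGroup.ker_mk']
      simp only [Subgroup.mem_subgroupOf, Subgroup.mem_inf, SetLike.coe_mem, and_true,
        Subgroup.mem_comap]
      exact Iff.rfl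
    refine ⟨inf_le_right, ⟨?_⟩, ?_, ?_⟩
    · rintro ⟨a, haF⟩ ⟨ha, ha'⟩ ⟨h, hh⟩
      refine ⟨?_, hconj h hh a ha'⟩
      have := hNF.conj_mem ⟨f a, hf haF⟩ ha ⟨f h, hf hh⟩
      simpa [Subgroup.mem_subgroupOf] using this
    · rw [hker]
      exact ⟨inferInstance, hNQ.of_injective _ (QuotientGroup.kerLift_injective _)⟩
    · intro h hh a ha
      refine ⟨?_, (nu H i).mul_mem (hconj h hh a ha) ((nu H i).inv_mem ha)⟩
      simpa using hNc (f h) (hf hh) (f a) (ih ha)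

theorem fitting_le_comap_of_surjective {H G : Type*} [Group H] [Group G] (f : H →* G)
    (hf : Function.Surjective f) : fitting H ≤ (fitting G).comap f := by
  refine sSup_le ?_
  rintro N ⟨hN, hnil⟩
  rw [← Subgroup.map_le_iff_le_comap]
  refine le_sSup ⟨hN.map f hf, ?_⟩
  exact Group.nilpotent_of_surjective (f.subgroupMap N) (f.subgroupMap_surjective N)

/-- If `ν_c(G) = 1` and `H/ν_c(H) ≅ G`, then every epimorphism `H → G` has the kernel `ν_c(H)`. -/
theorem ker_eq_nu_of_surjective {G H : Type*} [Group G] [Group H] [Finite H] {c : ℕ}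
    (hG : nu G c = ⊥) [(nu H c).Normal] (e : H ⧸ nu H c ≃* G) (f : H →* G)
    (hf : Function.Surjective f) : f.ker = nu H c := by
  have hle : nu H c ≤ f.ker := fun x hx => by
    have := nu_le_comap_nu f (fitting_le_comap_of_surjective f hf) c hx
    rwa [hG] at this
  have hindex : f.ker.index = (nu H c).index := by
    rw [Subgroup.index_ker, Subgroup.index, Nat.card_congr e.toEquiv, f.range_eq_top.2 hf,
      Subgroup.card_top]
  refine (Subgroup.eq_of_le_of_card_ge hle ?_).symm
  refine le_of_eq (Nat.eq_of_mul_eq_mul_right (Nat.pos_of_ne_zero f.ker.index_ne_zero_of_finite) ?_)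
  rw [Subgroup.card_mul_index, hindex, Subgroup.card_mul_index]

theorem mulAut_smul_eq_of_le {G : Type*} [Group G] [Finite G] (α : MulAut G) (S : Subgroup G)
    (h : ∀ x ∈ S, α x ∈ S) : α • S = S := by
  refine Subgroup.eq_of_le_of_card_ge ?_ (Nat.card_congr (Subgroup.equivSMul α S).toEquiv).le
  rintro _ ⟨x, hx, rfl⟩
  exact h x hx

/-! ### The covering group: finiteness, lifting of automorphisms, action on G*/U. -/

section Cover

variable {G : Type*} [Group G] {n : ℕ} (g : Fin n → G)

theorem presMap_surjective (hg : Subgroup.closure (Set.range g) = ⊤) :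
    Function.Surjective (presMap g) := by
  rw [← MonoidHom.range_eq_top, ← hg]
  exact FreeGroup.range_lift_eq_closure

theorem coveringKernel_le_ker : coveringKernel g ≤ (presMap g).ker := by
  refine sup_le (Subgroup.commutator_le_left _ _) ?_
  refine (Subgroup.closure_le _).2 ?_
  rintro _ ⟨x, hx, rfl⟩
  exact pow_mem hx _

/-- The projection of the covering group onto `G`. -/
def coverMap : CoveringGroup g →* G :=
  QuotientGroup.lift (coveringKernel g) (presMap g) (coveringKernel_le_ker g)

theorem coverMap_mk (x : FreeGroup (Fin n)) :
    coverMap g (QuotientGroup.mk' (coveringKernel g) x) = presMap g x := rfl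

theorem ker_coverMap : (coverMap g).ker = multiplicator g :=
  QuotientGroup.ker_lift _ _ (coveringKernel_le_ker g)

theorem core_ne_zero (n : ℕ) : core n ≠ 0 :=
  Finset.prod_ne_zero_iff.2 fun _ hp => (Nat.prime_of_mem_primeFactors hp).ne_zero

/-- R has finite index in a free group of finite rank, so it is finitely generated. Since R ≤ L, the
quotient R/K is abelian, and its exponent divides k ≠ 0. -/
theorem finite_multiplicator [Finite G] : Finite (multiplicator g) := by
  have hfg : Group.FG (multiplicator g) :=
    Group.fg_of_surjective ((QuotientGroup.mk' (coveringKernel g)).subgroupMap_surjective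
      (presMap g).ker)
  have hcomm : ∀ x y : multiplicator g, x * y = y * x := by
    rintro ⟨_, x, hx, rfl⟩ ⟨_, y, hy, rfl⟩
    refine Subtype.ext ?_
    have hy' : y ∈ (fitting G).comap (presMap g) := by
      rw [Subgroup.mem_comap, MonoidHom.mem_ker.1 hy]
      exact one_mem _
    have h : ⁅x, y⁆ ∈ coveringKernel g :=
      Subgroup.mem_sup_left (Subgroup.commutator_mem_commutator hx hy')
    have h1 := (QuotientGroup.eq_one_iff (N := coveringKernel g) _).2 h
    exact commutatorElement_eq_one_iff_mul_comm.1 h1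
  have hpow : ∀ x : multiplicator g, x ^ core (fRank G) = 1 := by
    rintro ⟨_, x, hx, rfl⟩
    refine Subtype.ext ?_
    exact (QuotientGroup.eq_one_iff (N := coveringKernel g) (x ^ core (fRank G))).2
      (Subgroup.mem_sup_right (Subgroup.subset_closure ⟨x, hx, rfl⟩))
  let : CommGroup (multiplicator g) :=
    { (inferInstance : Group (multiplicator g)) with mul_comm := hcomm }
  exact CommGroup.finite_of_fg_isMulTorsion _ fun x =>
    isOfFinOrder_iff_pow_eq_one.2 ⟨_, Nat.pos_of_ne_zero (core_ne_zero _), hpow x⟩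

theorem finite_coveringGroup [Finite G] : Finite (CoveringGroup g) := by
  have := finite_multiplicator g
  refine Nat.finite_of_card_ne_zero ?_
  rw [← Subgroup.card_mul_index (multiplicator g)]
  refine mul_ne_zero Nat.card_pos.ne' ?_
  rw [← ker_coverMap, Subgroup.index_ker]
  exact Nat.card_pos.ne'

theorem closure_range_mk_of :
    Subgroup.closure (Set.range fun i : Fin n =>
      QuotientGroup.mk' (coveringKernel g) (FreeGroup.of i)) = ⊤ := by
  change Subgroup.closure (Set.range (QuotientGroup.mk' (coveringKernel g) ∘ FreeGroup.of)) = ⊤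
  rw [Set.range_comp, ← MonoidHom.map_closure, FreeGroup.closure_range_of,
    Subgroup.map_top_of_surjective _ (QuotientGroup.mk'_surjective _)]

/-- Endomorphisms of the free group that induce a surjection of `G` respect the covering kernel. -/
theorem coveringKernel_le_comap (γ : FreeGroup (Fin n) →* FreeGroup (Fin n)) (δ : G →* G)
    (hδ : Function.Surjective δ) (h : ∀ x, presMap g (γ x) = δ (presMap g x)) :
    coveringKernel g ≤ (coveringKernel g).comap γ := by
  have hR : ∀ x ∈ (presMap g).ker, γ x ∈ (presMap g).ker := fun x hx => by
    rw [MonoidHom.mem_ker, h, MonoidHom.mem_ker.1 hx, map_one]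
  refine sup_le ?_ ((Subgroup.closure_le _).2 ?_)
  · rw [Subgroup.commutator_le]
    intro x hx y hy
    rw [Subgroup.mem_comap, map_commutatorElement]
    refine Subgroup.mem_sup_left (Subgroup.commutator_mem_commutator (hR x hx) ?_)
    rw [Subgroup.mem_comap, h]
    -- Surjectivity of δ is what makes it respect F(G), and hence γ respect L.
    exact fitting_le_comap_of_surjective δ hδ hy
  · rintro _ ⟨x, hx, rfl⟩
    refine Subgroup.mem_sup_right (Subgroup.subset_closure ⟨γ x, hR x hx, (map_pow γ x _).symm⟩)

/-- A generating family of the covering group whose image in `G` is the image of the standard one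
under `δ` gives rise to an automorphism of the covering group. -/
theorem exists_mulAut_coveringGroup [Finite G] (u : Fin n → CoveringGroup g)
    (hu : Subgroup.closure (Set.range u) = ⊤) (δ : G →* G) (hδ : Function.Surjective δ)
    (h : ∀ i, coverMap g (u i) = δ (g i)) :
    ∃ α : MulAut (CoveringGroup g),
      ∀ i, α (QuotientGroup.mk' (coveringKernel g) (FreeGroup.of i)) = u i := by
  choose v hv using fun i => QuotientGroup.mk'_surjective (coveringKernel g) (u i)
  have hγ : (presMap g).comp (FreeGroup.lift v) = δ.comp (presMap g) := by
    ext i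
    have h1 : presMap g (v i) = δ (g i) := by rw [← coverMap_mk, hv, h]
    simpa [presMap] using h1
  let γ := QuotientGroup.map _ _ (FreeGroup.lift v)
    (coveringKernel_le_comap g _ δ hδ (DFunLike.congr_fun hγ))
  have hγu : ∀ i, γ (QuotientGroup.mk' (coveringKernel g) (FreeGroup.of i)) = u i := fun i => by
    rw [← hv i, ← FreeGroup.lift_apply_of (f := v) (x := i)]
    rfl
  have hsurj : Function.Surjective γ := by
    rw [← MonoidHom.range_eq_top, eq_top_iff, ← hu, Subgroup.closure_le]
    rintro _ ⟨i, rfl⟩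
    exact ⟨_, hγu i⟩
  have := finite_coveringGroup g
  exact ⟨MulEquiv.ofBijective γ (Finite.injective_iff_surjective.2 hsurj |> fun hi => ⟨hi, hsurj⟩),
    hγu⟩

/-- Two homomorphisms from the covering group agree if they agree on the standard generators. -/
theorem coveringGroup_hom_ext {A : Type*} [Group A] {f f' : CoveringGroup g →* A}
    (h : ∀ i, f (QuotientGroup.mk' (coveringKernel g) (FreeGroup.of i)) =
      f' (QuotientGroup.mk' (coveringKernel g) (FreeGroup.of i))) : f = f' := by
  refine QuotientGroup.monoidHom_ext _ ?_
  ext i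
  exact h i

theorem map_eq_of_mem_stabilizer (U : Subgroup (CoveringGroup g)) (α : MulAction.stabilizer (autM g) U) :
    U.map ((α : MulAut (CoveringGroup g)) : CoveringGroup g →* CoveringGroup g) = U :=
  α.2

variable (U : Subgroup (CoveringGroup g)) [U.Normal]

/-- The action on `G*/U` of the stabilizer of `U`. -/
def stabilizerToMulAut :
    MulAction.stabilizer (autM g) U →* MulAut (CoveringGroup g ⧸ U) where
  toFun α := QuotientGroup.congr U U (α : MulAut (CoveringGroup g)) (map_eq_of_mem_stabilizer g U α)
  map_one' := by
    ext x
    obtain ⟨x, rfl⟩ := QuotientGroup.mk_surjective x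
    rfl
  map_mul' α β := by
    ext x
    obtain ⟨x, rfl⟩ := QuotientGroup.mk_surjective x
    rfl

theorem stabilizerToMulAut_mk (α : MulAction.stabilizer (autM g) U) (x : CoveringGroup g) :
    stabilizerToMulAut g U α (QuotientGroup.mk x) =
      QuotientGroup.mk ((α : MulAut (CoveringGroup g)) x) := rfl

theorem stabilizerToMulAut_surjective [Finite G] (hg : Subgroup.closure (Set.range g) = ⊤)
    (hUM : U ≤ multiplicator g) (hU : IsDescendant G (CoveringGroup g ⧸ U)) :
    Function.Surjective (stabilizerToMulAut g U) := by
  intro β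
  have := finite_coveringGroup g
  obtain ⟨c, hc, -, hn, ⟨e⟩⟩ := hU
  rw [← ker_coverMap] at hUM
  let π : CoveringGroup g ⧸ U →* G := QuotientGroup.lift U (coverMap g) hUM
  have hcover : Function.Surjective (coverMap g) := fun y => by
    obtain ⟨x, hx⟩ := presMap_surjective g hg y
    exact ⟨QuotientGroup.mk' _ x, hx⟩
  have hπ : Function.Surjective π := fun y => by
    obtain ⟨x, hx⟩ := hcover y
    exact ⟨QuotientGroup.mk' U x, hx⟩
  have hker := ker_eq_nu_of_surjective hc.1 e π hπ
  -- The kernel of π is ν_c(H), which β preserves; hence β descends to δ on G.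
  have hβ : π.ker ≤ (π.comp (β : CoveringGroup g ⧸ U →* CoveringGroup g ⧸ U)).ker := by
    rw [← MonoidHom.comap_ker, hker]
    exact nu_le_comap_nu _ (fitting_le_comap_of_surjective _ β.surjective) c
  let δ : G →* G := π.liftOfSurjective hπ ⟨_, hβ⟩
  have hδ : ∀ x, δ (π x) = π (β x) := fun x =>
    π.liftOfRightInverse_comp_apply _ (Function.rightInverse_surjInv hπ) ⟨_, hβ⟩ x
  have hδs : Function.Surjective δ := fun y => by
    obtain ⟨x, rfl⟩ := hπ y
    exact ⟨π (β.symm x), by rw [hδ, MulEquiv.apply_symm_apply]⟩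
  let t : Fin n → CoveringGroup g := fun i => QuotientGroup.mk' (coveringKernel g) (FreeGroup.of i)
  let q : CoveringGroup g →* CoveringGroup g ⧸ U := QuotientGroup.mk' U
  let f : CoveringGroup g →* CoveringGroup g ⧸ U :=
    (β : CoveringGroup g ⧸ U →* CoveringGroup g ⧸ U).comp q
  have hq : Function.Surjective q := QuotientGroup.mk'_surjective U
  -- Arbitrary lifts of the β-images need not generate G*; Gaschütz's lemma supplies ones that do.
  obtain ⟨u, hu, hgen⟩ := exists_generating_lift q hq t (closure_range_mk_of g) (f ∘ t) (by
    rw [Set.range_comp, ← MonoidHom.map_closure, closure_range_mk_of g,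
      Subgroup.map_top_of_surjective f (β.surjective.comp hq)])
  obtain ⟨α, hα⟩ := exists_mulAut_coveringGroup g u hgen δ hδs fun i => by
    have h1 : coverMap g (u i) = π (f (t i)) := congrArg π (congrFun hu i)
    have h2 : π (q (t i)) = g i := FreeGroup.lift_apply_of
    rw [h1, ← h2, hδ]
    rfl
  have hαβ : ∀ x, q (α x) = β (q x) := DFunLike.congr_fun <|
    coveringGroup_hom_ext g (f := q.comp α.toMonoidHom) (f' := f) fun i =>
      (congrArg q (hα i)).trans (congrFun hu i)
  have hαM : α ∈ autM g := mulAut_smul_eq_of_le α _ fun x hx => by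
    rw [← ker_coverMap, MonoidHom.mem_ker] at hx ⊢
    have h1 : coverMap g (α x) = π (β (q x)) := congrArg π (hαβ x)
    have h2 : π (q x) = 1 := hx
    rw [h1, ← hδ, h2, map_one]
  have hαU : α • U = U := mulAut_smul_eq_of_le α _ fun x hx => by
    have h : q x = 1 := (QuotientGroup.eq_one_iff x).2 hx
    refine (QuotientGroup.eq_one_iff (α x)).1 ((hαβ x).trans ?_)
    rw [h, map_one]
  refine ⟨⟨⟨α, hαM⟩, hαU⟩, MulEquiv.ext fun x => ?_⟩
  obtain ⟨x, rfl⟩ := hq x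
  exact hαβ x

end Cover

end FCentral

end

theorem mainTheorem10 {G : Type*} [Group G] [Finite G] {n : ℕ} (g : Fin n → G)
    (hg : Subgroup.closure (Set.range g) = ⊤)
    (U : Subgroup (FCentral.CoveringGroup g)) [U.Normal]
    (hUM : U ≤ FCentral.multiplicator g)
    (hU : FCentral.IsDescendant G (FCentral.CoveringGroup g ⧸ U)) :
    ∃ φ : MulAction.stabilizer (FCentral.autM g) U →* MulAut (FCentral.CoveringGroup g ⧸ U),
      (∀ (α : MulAction.stabilizer (FCentral.autM g) U) (x : FCentral.CoveringGroup g),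
        φ α (QuotientGroup.mk x) =
          QuotientGroup.mk ((α : MulAut (FCentral.CoveringGroup g)) x)) ∧
      Function.Surjective φ :=
  ⟨FCentral.stabilizerToMulAut g U, FCentral.stabilizerToMulAut_mk g U,
    FCentral.stabilizerToMulAut_surjective g U hg hUM hU⟩
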